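/- Let $\alpha\in(1,2)$, let $H$ and $\Sigma$ be symmetric positive definite real $d\times d$ matrices with $\Sigma H=H\Sigma$, and let $c>0$ satisfy $c>(1-\alpha^{-1})/\lambda_{\min}(H)$, where $\lambda_{\min}(H)$ is the smallest eigenvalue of $H$. Let $(L_t)_{t\ge 0}$ be an $\mathbb{R}^d$-valued Lévy process that is elliptically contoured $\alpha$-stable with scale matrix $\Sigma$, that is, $\log\mathbb{E}[e^{iu^\top L_t}]=-t\,(u^\top\Sigma u)^{\alpha/2}$ for all $t\ge 0$ and $u\in\mathbb{R}^d$. Consider the limit laws of stochastic gradient descent with Hessian $H$ at the minimizer, $$Z_{\mathrm{final},1}\overset{d}{=}c^{1-\frac1\alpha}\int_0^\infty \exp(-H_1 t)\,dL_t,\qquad H_1=H-\frac{1-\alpha^{-1}}{c}I,\qquad\qquad Z_{\mathrm{Polyak}}\overset{d}{=}H^{-1}L_1,$$ of the final iterate with step sizes $\eta_n=c\,n^{-1}$ and of the Polyak–Ruppert average, respectively. Here $\int_0^T \exp(-H_1t)\,dL_t$ is the limit in probability of left-point Riemann–Stieltjes sums over partitions of $[0,T]$ with mesh tending to $0$, and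 $\int_0^\infty$ is the limit in probability of $\int_0^T$ as $T\to\infty$. For a random vector $Z$ and a direction $u$, say that $Z$ has scale $\sigma_\alpha(Z;u)=\sigma$ if for some $b\in\mathbb{R}$ one has $\mathbb{E}[e^{is\,u^\top Z}]=\exp(-\sigma|s|^\alpha+isb)$ for all $s\in\mathbb{R}$; such a $\sigma$ is unique, and it equals $(u^\top\Sigma u)^{\alpha/2}$ if $Z$ is elliptically contoured $\alpha$-stable with scale matrix $\Sigma$. Then the integral $\int_0^\infty \exp(-H_1t)\,dL_t$ exists, and for every $u\in\mathbb{R}^d$ with $\|u\|=1$ both $Z_{\mathrm{final},1}$ and $Z_{\mathrm{Polyak}}$ have a scale in direction $u$, with $$\sigma_\alpha(Z_{\mathrm{final},1};u)\ \ge\ \sigma_\alpha(Z_{\mathrm{Polyak}};u).$$ -/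

import Mathlib

open MeasureTheory ProbabilityTheory Filter Topology
open scoped NNReal Matrix

/-- `L` is a Lévy process under `P`: it starts at `0`, has independent and stationary increments,
is stochastically continuous, and almost all its paths are right-continuous with left limits. -/
structure IsLevyProcess {Ω E : Type*} [MeasurableSpace Ω] [NormedAddCommGroup E]
    [MeasurableSpace E] (L : ℝ≥0 → Ω → E) (P : Measure Ω) : Prop where
  measurable : ∀ t, Measurable (L t)
  start_zero : ∀ᵐ ω ∂P, L 0 ω = 0
  indep_increments : HasIndepIncrements L P
  stationary_increments : ∀ s t : ℝ≥0,
    IdentDistrib (fun ω => L (s + t) ω - L s ω) (L t) P P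
  stoch_continuous : ∀ t, TendstoInMeasure P L (𝓝 t) (L t)
  cadlag : ∀ᵐ ω ∂P, ∀ t : ℝ≥0, ContinuousWithinAt (fun s => L s ω) (Set.Ici t) t ∧
    ∃ l : E, Tendsto (fun s => L s ω) (𝓝[<] t) (𝓝 l)

/-- A partition `0 = t₀ ≤ t₁ ≤ … ≤ tₙ = T` of the interval `[0, T]` (the values of `point` beyond
the index `size` play no role). -/
structure TimePartition (T : ℝ≥0) where
  size : ℕ
  point : ℕ → ℝ≥0
  mono : Monotone point
  point_zero : point 0 = 0
  point_size : point size = T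

/-- The largest step of a partition. -/
noncomputable def TimePartition.mesh {T : ℝ≥0} (π : TimePartition T) : ℝ≥0 :=
  (Finset.range π.size).sup fun k => π.point (k + 1) - π.point k

/-- The left-point Riemann–Stieltjes sum `∑ₖ f(tₖ) (L_{tₖ₊₁} - L_{tₖ})`. -/
noncomputable def TimePartition.riemannSum {T : ℝ≥0} (π : TimePartition T)
    {Ω E : Type*} [NormedAddCommGroup E] [NormedSpace ℝ E]
    (f : ℝ≥0 → E →L[ℝ] E) (L : ℝ≥0 → Ω → E) (ω : Ω) : E :=
  ∑ k ∈ Finset.range π.size, f (π.point k) (L (π.point (k + 1)) ω - L (π.point k) ω)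

/-- `Y` is (a version of) the integral `∫₀ᵀ f(t) dL_t` of the deterministic operator-valued function
`f` (meant for continuous `f`): the Riemann–Stieltjes sums converge to `Y` in probability along
every sequence of partitions of `[0, T]` whose mesh tends to `0`. -/
def IsLevyIntegral {Ω E : Type*} [MeasurableSpace Ω] [NormedAddCommGroup E] [NormedSpace ℝ E]
    (P : Measure Ω) (f : ℝ≥0 → E →L[ℝ] E) (L : ℝ≥0 → Ω → E) (T : ℝ≥0) (Y : Ω → E) : Prop :=
  ∀ π : ℕ → TimePartition T, Tendsto (fun n => (π n).mesh) atTop (𝓝 0) →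
    TendstoInMeasure P (fun n => (π n).riemannSum f L) atTop Y

/-- `X` is (a version of) the improper integral `∫₀^∞ f(t) dL_t`, the limit in probability of
`∫₀ᵀ f(t) dL_t` as `T → ∞`. -/
def IsImproperLevyIntegral {Ω E : Type*} [MeasurableSpace Ω] [NormedAddCommGroup E]
    [NormedSpace ℝ E] (P : Measure Ω) (f : ℝ≥0 → E →L[ℝ] E) (L : ℝ≥0 → Ω → E)
    (X : Ω → E) : Prop :=
  ∃ Y : ℝ≥0 → Ω → E, (∀ T, IsLevyIntegral P f L T (Y T)) ∧ TendstoInMeasure P Y atTop X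

/-- In direction `u`, the law `μ` is symmetric `α`-stable, up to a location `b`, with scale `σ`:
`E exp(i s ⟨u, Z⟩) = exp(-σ |s|^α + i s b)` for all real `s`, where `Z` has law `μ`. -/
def HasStableScale {d : ℕ} (α : ℝ) (μ : Measure (EuclideanSpace ℝ (Fin d)))
    (u : EuclideanSpace ℝ (Fin d)) (σ : ℝ) : Prop :=
  ∃ b : ℝ, ∀ s : ℝ,
    charFun μ (s • u) = Complex.exp (-((σ * |s| ^ α : ℝ) : ℂ) + ((s * b : ℝ) : ℂ) * Complex.I)

/-- The scale of a law in a given direction is unique. -/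
theorem HasStableScale.unique {d : ℕ} {α : ℝ} {μ : Measure (EuclideanSpace ℝ (Fin d))}
    {u : EuclideanSpace ℝ (Fin d)} {σ τ : ℝ} (h₁ : HasStableScale α μ u σ)
    (h₂ : HasStableScale α μ u τ) : σ = τ := by
  obtain ⟨b, hb⟩ := h₁
  obtain ⟨b', hb'⟩ := h₂
  have h := congrArg norm ((hb 1).symm.trans (hb' 1))
  simpa [Complex.norm_exp] using h

/-- For an elliptically contoured stable law with scale matrix `S` and location `x`, the scale in
direction `u` is `(uᵀ S u)^(α/2)`. -/
theorem hasStableScale_of_elliptical {d : ℕ} {α : ℝ} {μ : Measure (EuclideanSpace ℝ (Fin d))}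
    {S : Matrix (Fin d) (Fin d) ℝ} (hS : S.PosDef) (x : EuclideanSpace ℝ (Fin d))
    (h : ∀ v : EuclideanSpace ℝ (Fin d), charFun μ v =
      Complex.exp (-(((v.ofLp ⬝ᵥ S *ᵥ v.ofLp) ^ (α / 2) : ℝ) : ℂ)
        + ((v.ofLp ⬝ᵥ x.ofLp : ℝ) : ℂ) * Complex.I))
    (u : EuclideanSpace ℝ (Fin d)) :
    HasStableScale α μ u ((u.ofLp ⬝ᵥ S *ᵥ u.ofLp) ^ (α / 2)) := by
  refine ⟨u.ofLp ⬝ᵥ x.ofLp, fun s => ?_⟩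
  have hq : 0 ≤ u.ofLp ⬝ᵥ S *ᵥ u.ofLp := by
    simpa using hS.posSemidef.dotProduct_mulVec_nonneg u.ofLp
  have hs : ((s • u).ofLp ⬝ᵥ S *ᵥ (s • u).ofLp) ^ (α / 2)
      = (u.ofLp ⬝ᵥ S *ᵥ u.ofLp) ^ (α / 2) * |s| ^ α := by
    have : (s • u).ofLp ⬝ᵥ S *ᵥ (s • u).ofLp = (u.ofLp ⬝ᵥ S *ᵥ u.ofLp) * |s| ^ (2 : ℝ) := by
      simp [Matrix.mulVec_smul]
      ring
    rw [this, Real.mul_rpow hq (by positivity), ← Real.rpow_mul (abs_nonneg s)]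
    congr 2
    ring
  rw [h, hs]
  simp

/-- The integrand `t ↦ exp(-H₁ t)`, `H₁ = H - ((1 - 1/α) / c) I`, of the final-iterate limit for
the step sizes `c / n`. -/
noncomputable def finalKernel {d : ℕ} (H : Matrix (Fin d) (Fin d) ℝ) (α c : ℝ) (t : ℝ≥0) :
    EuclideanSpace ℝ (Fin d) →L[ℝ] EuclideanSpace ℝ (Fin d) :=
  Matrix.toEuclideanCLM (𝕜 := ℝ) (n := Fin d)
    (NormedSpace.exp (-((t : ℝ) • (H - ((1 - α⁻¹) / c) • (1 : Matrix (Fin d) (Fin d) ℝ)))))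

/-!
The integral is controlled entirely through characteristic functions. Write
`φ v = (vᵀ S v)^(α/2)` for the characteristic exponent of `L`. Independence and stationarity of the
increments give, for any finite linear combination,
`E exp(i ⟨u, ∑ᵢ Cᵢ L_{rᵢ}⟩) = exp(-∫₀^∞ φ((∑ᵢ 1_{t < rᵢ} Cᵢ)ᵀ u) dt)`
(`IsLevyProcess.charFun_sum`). This formula does not depend on how the combination is written, so
the difference of two Riemann–Stieltjes sums over different partitions is handled without a common
refinement: its exponent is the integral of `φ` along the difference of two step functions
approximating `f`, and it tends to `0` by dominated convergence. By Lévy's convergence theorem the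
Riemann–Stieltjes sums are Cauchy in probability, hence converge. The same argument applied to
`∫₀ᵀ f dL - ∫₀ˢ f dL` yields the improper integral as soon as `t ↦ φ(f(t)ᵀ u)` is integrable, and
shows that the limit has characteristic exponent `∫₀^∞ φ(f(t)ᵀ u) dt`
(`IsLevyProcess.exists_isImproperLevyIntegral`, `IsImproperLevyIntegral.charFun_eq`).

For the comparison of scales, `S` is replaced by the square of its square root, which commutes with
`H`. In an eigenbasis of `H`, with eigenvalues `hᵢ`, there are weights `wᵢ ≥ 0` such that the scale
of the average is `A^(α/2)`, `A = ∑ᵢ wᵢ hᵢ⁻²`, and that of the final iterate is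
`c^(α-1) ∫₀^∞ (∑ᵢ wᵢ exp(-2 lᵢ t))^(α/2) dt`, `lᵢ = hᵢ - (1 - 1/α)/c`. Since `α/2 ≤ 1`, Jensen's
inequality with the probability weights `wᵢ hᵢ⁻² / A` bounds the latter from below by the average of
the one-dimensional ratios `c^(α-1) hᵢ^α / (α lᵢ)` times `A^(α/2)`, and each ratio is at least `1`:
this is Bernoulli's inequality `(c hᵢ)^α ≥ 1 + α (c hᵢ - 1)`
(`rpow_sum_inv_sq_le_integral`).
-/

/-! ### Convergence in probability and characteristic functions -/

section ConvergenceInMeasure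

open scoped ENNReal

variable {Ω E ι : Type*} [MeasurableSpace Ω] {P : Measure Ω}

theorem MeasureTheory.TendstoInMeasure.add [SeminormedAddCommGroup E] {l : Filter ι}
    {X X' : ι → Ω → E} {Y Y' : Ω → E} (h : TendstoInMeasure P X l Y)
    (h' : TendstoInMeasure P X' l Y') :
    TendstoInMeasure P (fun i => X i + X' i) l (Y + Y') := by
  rw [tendstoInMeasure_iff_norm] at *
  intro ε hε
  have hsum := (h (ε / 2) (half_pos hε)).add (h' (ε / 2) (half_pos hε))
  rw [add_zero] at hsum
  refine tendsto_of_tendsto_of_tendsto_of_le_of_le tendsto_const_nhds hsum (fun _ => zero_le)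
    fun i => (measure_mono fun ω hω => ?_).trans (measure_union_le _ _)
  simp only [Set.mem_union, Set.mem_ofPred_eq, Pi.add_apply] at hω ⊢
  by_contra! hlt
  have := norm_add_le (X i ω - Y ω) (X' i ω - Y' ω)
  rw [add_sub_add_comm] at hω
  linarith [hlt.1, hlt.2]

theorem MeasureTheory.TendstoInMeasure.neg [SeminormedAddCommGroup E] {l : Filter ι}
    {X : ι → Ω → E} {Y : Ω → E} (h : TendstoInMeasure P X l Y) :
    TendstoInMeasure P (fun i => -X i) l (-Y) := by
  rw [tendstoInMeasure_iff_norm] at *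
  intro ε hε
  simpa [← neg_add', ← sub_eq_neg_add, norm_sub_rev, neg_add_eq_sub] using h ε hε

theorem MeasureTheory.TendstoInMeasure.sub [SeminormedAddCommGroup E] {l : Filter ι}
    {X X' : ι → Ω → E} {Y Y' : Ω → E} (h : TendstoInMeasure P X l Y)
    (h' : TendstoInMeasure P X' l Y') :
    TendstoInMeasure P (fun i => X i - X' i) l (Y - Y') := by
  simpa [sub_eq_add_neg] using h.add h'.neg

/-- Completeness of convergence in measure for sequences: a subsequence with summable deviations
converges almost everywhere by the Borel–Cantelli lemma. -/
theorem exists_tendstoInMeasure_of_cauchySeq [IsFiniteMeasure P] [NormedAddCommGroup E]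
    [CompleteSpace E] {X : ℕ → Ω → E} (hX : ∀ n, AEStronglyMeasurable (X n) P)
    (hC : TendstoInMeasure P (fun p : ℕ × ℕ => X p.1 - X p.2) (atTop ×ˢ atTop) 0) :
    ∃ Y : Ω → E, TendstoInMeasure P X atTop Y := by
  have hev : ∀ n : ℕ, ∀ᶠ k in atTop, ∀ m ≥ k,
      P {ω | (2 : ℝ≥0∞)⁻¹ ^ n ≤ edist (X k ω) (X m ω)} ≤ (2 : ℝ≥0∞)⁻¹ ^ n := by
    intro n
    have hpos : (0 : ℝ≥0∞) < (2 : ℝ≥0∞)⁻¹ ^ n := ENNReal.pow_pos (by simp) _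
    have h := (hC _ hpos).eventually_le_const hpos
    rw [prod_atTop_atTop_eq, eventually_atTop] at h
    obtain ⟨⟨a, b⟩, hab⟩ := h
    filter_upwards [eventually_ge_atTop (max a b)] with k hk m hm
    have := hab (k, m) ⟨(le_max_left _ _).trans hk, ((le_max_right _ _).trans hk).trans hm⟩
    simpa [edist_eq_enorm_sub] using this
  -- a subsequence whose consecutive differences exceed `2⁻ⁿ` with probability at most `2⁻ⁿ`
  obtain ⟨φ, hφ, hφP⟩ := extraction_forall_of_eventually hev
  have hae : ∀ᵐ ω ∂P, ∃ y, Tendsto (fun n => X (φ n) ω) atTop (𝓝 y) := by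
    have hsum : ∑' n, P {ω | (2 : ℝ≥0∞)⁻¹ ^ n ≤ edist (X (φ n) ω) (X (φ (n + 1)) ω)} ≠ ∞ := by
      refine ne_top_of_le_ne_top ?_
        (ENNReal.tsum_le_tsum fun n => hφP n _ (hφ.monotone n.le_succ))
      simp [ENNReal.tsum_geometric]
    filter_upwards [ae_eventually_notMem hsum] with ω hω
    obtain ⟨N, hN⟩ := eventually_atTop.1 hω
    apply cauchySeq_tendsto_of_complete
    refine (cauchySeq_shift (u := fun n => X (φ n) ω) N).1 ?_
    refine cauchySeq_of_edist_le_geometric (2 : ℝ≥0∞)⁻¹ 1 (by simp) (by simp) fun n => ?_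
    have h := hN (n + N) (Nat.le_add_left _ _)
    simp only [not_le] at h
    rw [one_mul, show n + 1 + N = n + N + 1 by ring]
    exact h.le.trans (pow_le_pow_right_of_le_one' (by simp) (Nat.le_add_right _ _))
  classical
  refine ⟨fun ω => if h : ∃ y, Tendsto (fun n => X (φ n) ω) atTop (𝓝 y) then h.choose else 0, ?_⟩
  set Y : Ω → E := fun ω =>
    if h : ∃ y, Tendsto (fun n => X (φ n) ω) atTop (𝓝 y) then h.choose else 0 with hY
  have hsub : TendstoInMeasure P (fun n => X (φ n)) atTop Y := by
    refine tendstoInMeasure_of_tendsto_ae (fun n => hX _) ?_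
    filter_upwards [hae] with ω hω
    simp only [hY, dif_pos hω]
    exact hω.choose_spec
  have hdiff : TendstoInMeasure P (fun n => X n - X (φ n)) atTop 0 :=
    hC.comp (ns := fun n => (n, φ n)) (tendsto_id.prodMk hφ.tendsto_atTop)
  have := hdiff.add hsub
  simpa using this

/-- Completeness of convergence in measure along a countably generated filter. -/
theorem exists_tendstoInMeasure_of_cauchy [IsFiniteMeasure P] [NormedAddCommGroup E]
    [CompleteSpace E] {l : Filter ι} [l.NeBot] [l.IsCountablyGenerated]
    {X : ι → Ω → E} (hX : ∀ n, AEStronglyMeasurable (X n) P)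
    (hC : TendstoInMeasure P (fun p : ι × ι => X p.1 - X p.2) (l ×ˢ l) 0) :
    ∃ Y : Ω → E, TendstoInMeasure P X l Y := by
  obtain ⟨x, hx⟩ := exists_seq_tendsto l
  have hCx : TendstoInMeasure P (fun p : ℕ × ℕ => X (x p.1) - X (x p.2)) (atTop ×ˢ atTop) 0 :=
    hC.comp (ns := fun p : ℕ × ℕ => (x p.1, x p.2)) (hx.prodMap hx)
  obtain ⟨Y, hY⟩ := exists_tendstoInMeasure_of_cauchySeq (fun n => hX (x n)) hCx
  refine ⟨Y, ?_⟩
  intro ε hε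
  refine tendsto_of_seq_tendsto fun y hy => ?_
  have h1 : TendstoInMeasure P (fun n => X (y n) - X (x n)) atTop 0 :=
    hC.comp (ns := fun n => (y n, x n)) (hy.prodMk hx)
  have h2 := h1.add hY
  simp only [sub_add_cancel, zero_add] at h2
  exact h2 ε hε

variable [NormedAddCommGroup E] [InnerProductSpace ℝ E]
  [MeasurableSpace E] [BorelSpace E]

/-- Convergence in probability implies pointwise convergence of the characteristic functions. -/
theorem MeasureTheory.TendstoInMeasure.tendsto_charFun [IsProbabilityMeasure P] {l : Filter ι}
    [l.NeBot] [l.IsCountablyGenerated] {X : ι → Ω → E} {Y : Ω → E} (hX : ∀ i, AEMeasurable (X i) P)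
    (h : TendstoInMeasure P X l Y) (u : E) :
    Tendsto (fun i => charFun (P.map (X i)) u) l (𝓝 (charFun (P.map Y) u)) := by
  have h' := (h.tendstoInDistribution hX).tendsto
  replace h' := (ProbabilityMeasure.tendsto_iff_forall_integral_rclike_tendsto ℂ).1 h'
  simp_rw [charFun_eq_integral_innerProbChar]
  exact h' (BoundedContinuousFunction.innerProbChar u)

variable [FiniteDimensional ℝ E]

/-- If the characteristic functions tend to `1` pointwise, the random vectors tend to `0` in
probability: the special case of Lévy's convergence theorem with a constant limit. -/
theorem tendstoInMeasure_zero_of_charFun [IsProbabilityMeasure P] {l : Filter ι}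
    [l.IsCountablyGenerated] {X : ι → Ω → E} (hX : ∀ i, AEMeasurable (X i) P)
    (h : ∀ u, Tendsto (fun i => charFun (P.map (X i)) u) l (𝓝 1)) :
    TendstoInMeasure P X l 0 := by
  refine tendstoInMeasure_iff_norm.2 fun ε hε => tendsto_of_seq_tendsto fun x hx => ?_
  let μ : ℕ → ProbabilityMeasure E := fun n =>
    ⟨P.map (X (x n)), Measure.isProbabilityMeasure_map (hX _)⟩
  let μ₀ : ProbabilityMeasure E := ⟨Measure.dirac 0, inferInstance⟩
  have hμ : Tendsto μ atTop (𝓝 μ₀) := by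
    refine ProbabilityMeasure.tendsto_of_tendsto_charFun fun u => ?_
    have : charFun (μ₀ : Measure E) u = 1 := by simp [μ₀, charFun_dirac]
    rw [this]
    exact (h u).comp hx
  have hcl : IsClosed {y : E | ε ≤ ‖y‖} := isClosed_le continuous_const continuous_norm
  have hfr : (μ₀ : Measure E) (frontier {y : E | ε ≤ ‖y‖}) = 0 := by
    refine measure_mono_null hcl.frontier_subset ?_
    simp [μ₀, Measure.dirac_apply' _ hcl.measurableSet, hε]
  have := ProbabilityMeasure.tendsto_measure_of_null_frontier_of_tendsto' hμ hfr
  have h0 : (μ₀ : Measure E) {y : E | ε ≤ ‖y‖} = 0 := by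
    simp [μ₀, Measure.dirac_apply' _ hcl.measurableSet, hε]
  rw [h0] at this
  refine this.congr fun n => ?_
  simp only [μ, ProbabilityMeasure.coe_mk, Pi.zero_apply, sub_zero]
  rw [Measure.map_apply_of_aemeasurable (hX _) hcl.measurableSet]
  rfl

theorem charFun_map_continuousLinearMap {μ : Measure E} (A : E →L[ℝ] E) (u : E) :
    charFun (μ.map A) u = charFun μ (A.adjoint u) := by
  rw [charFun_apply, charFun_apply, integral_map (by fun_prop) (by fun_prop)]
  simp_rw [ContinuousLinearMap.adjoint_inner_right]

end ConvergenceInMeasure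

/-! ### Partitions and step functions -/

section Partition

/-- A point between the first and the last value of a monotone sequence lies in one of the steps. -/
theorem exists_mem_Ico_of_monotone {α : Type*} [LinearOrder α] {r : ℕ → α} {n : ℕ} {t : α}
    (h0 : r 0 ≤ t) (hn : t < r n) : ∃ k < n, r k ≤ t ∧ t < r (k + 1) := by
  classical
  have hex : ∃ m, t < r m := ⟨n, hn⟩
  obtain ⟨k, hk⟩ : ∃ k, Nat.find hex = k + 1 := by
    refine Nat.exists_eq_succ_of_ne_zero fun h => ?_
    have := Nat.find_spec hex
    rw [h] at this
    exact absurd this (not_lt.2 h0)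
  refine ⟨k, ?_, ?_, ?_⟩
  · have := Nat.find_min' hex hn
    omega
  · exact not_lt.1 (Nat.find_min hex (m := k) (by omega))
  · rw [← hk]
    exact Nat.find_spec hex

/-- The step function `∑ₖ f(tₖ) 1_{[tₖ, tₖ₊₁)}` on `[0, ∞)`, whose integral against `L` is the
Riemann–Stieltjes sum. Each indicator is written as `1_{t < tₖ₊₁} - 1_{t < tₖ}`, the form in which
the characteristic functions of linear combinations of the `L_{tₖ}` produce it. -/
noncomputable def TimePartition.step {T : ℝ≥0} (π : TimePartition T) {F : Type*} [AddCommGroup F]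
    (f : ℝ≥0 → F) (t : ℝ) : F :=
  ∑ k ∈ Finset.range π.size, ((if t < π.point (k + 1) then f (π.point k) else 0)
    - if t < π.point k then f (π.point k) else 0)

variable {T : ℝ≥0} (π : TimePartition T) {F : Type*} [AddCommGroup F] (f : ℝ≥0 → F)

theorem TimePartition.point_le {k : ℕ} (hk : k ≤ π.size) : π.point k ≤ T :=
  (π.mono hk).trans_eq π.point_size

theorem TimePartition.step_of_le {t : ℝ} (ht : (T : ℝ) ≤ t) : π.step f t = 0 := by
  refine Finset.sum_eq_zero fun k hk => ?_
  rw [Finset.mem_range] at hk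
  have h1 : (π.point (k + 1) : ℝ) ≤ t := (NNReal.coe_le_coe.2 (π.point_le hk)).trans ht
  have h2 : (π.point k : ℝ) ≤ t := (NNReal.coe_le_coe.2 (π.point_le hk.le)).trans ht
  simp [h1.not_gt, h2.not_gt]

/-- The step function takes the value of `f` at a point within one mesh to the left of the
argument. -/
theorem TimePartition.exists_step_eq {t : ℝ} (h0 : 0 ≤ t) (ht : t < T) :
    ∃ s : ℝ≥0, (s : ℝ) ≤ t ∧ t ≤ s + π.mesh ∧ π.step f t = f s := by
  obtain ⟨k, hk, hk1, hk2⟩ := exists_mem_Ico_of_monotone (r := fun k => (π.point k : ℝ))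
    (n := π.size) (t := t) (by simpa [π.point_zero] using h0) (by simpa [π.point_size] using ht)
  refine ⟨π.point k, hk1, ?_, ?_⟩
  · have h := Finset.le_sup (f := fun k => π.point (k + 1) - π.point k) (Finset.mem_range.2 hk)
    have h' : π.point (k + 1) - π.point k ≤ π.mesh := h
    rw [tsub_le_iff_left] at h'
    exact hk2.le.trans (by exact_mod_cast h')
  · rw [TimePartition.step, Finset.sum_eq_single k]
    · simp [hk2, hk1.not_gt]
    · intro j _ hj
      rcases lt_or_gt_of_ne hj with hj | hj
      · have h1 : (π.point (j + 1) : ℝ) ≤ t := (NNReal.coe_le_coe.2 (π.mono hj)).trans hk1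
        have h2 : (π.point j : ℝ) ≤ t := (NNReal.coe_le_coe.2 (π.mono hj.le)).trans hk1
        simp [h1.not_gt, h2.not_gt]
      · have h1 : t < π.point j := hk2.trans_le (NNReal.coe_le_coe.2 (π.mono hj))
        have h2 : t < π.point (j + 1) := h1.trans_le (NNReal.coe_le_coe.2 (π.mono j.le_succ))
        simp [h1, h2]
    · intro h
      exact absurd (Finset.mem_range.2 hk) h

theorem TimePartition.tendsto_step {ι : Type*} {l : Filter ι} {F : Type*} [NormedAddCommGroup F]
    {f : ℝ≥0 → F} (hf : Continuous f) {π : ι → TimePartition T}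
    (hπ : Tendsto (fun i => (π i).mesh) l (𝓝 0)) {t : ℝ} (h0 : 0 ≤ t) :
    Tendsto (fun i => (π i).step f t) l (𝓝 (if t < T then f t.toNNReal else 0)) := by
  split_ifs with ht
  · choose s hs1 hs2 hs3 using fun i => (π i).exists_step_eq f h0 ht
    simp_rw [hs3]
    refine (hf.tendsto _).comp ?_
    rw [← NNReal.tendsto_coe, Real.coe_toNNReal _ h0]
    have hm : Tendsto (fun i => t - ((π i).mesh : ℝ)) l (𝓝 t) := by
      simpa using (NNReal.tendsto_coe.2 hπ).const_sub t
    exact tendsto_of_tendsto_of_tendsto_of_le_of_le hm tendsto_const_nhds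
      (fun i => by have := hs2 i; simp only; linarith) hs1
  · simp_rw [(π _).step_of_le f (not_lt.1 ht)]
    exact tendsto_const_nhds

theorem TimePartition.exists_norm_step_le {F : Type*} [NormedAddCommGroup F]
    {f : ℝ≥0 → F} (hf : Continuous f) (T : ℝ≥0) :
    ∃ M, ∀ (π : TimePartition T) (t : ℝ), 0 ≤ t → ‖π.step f t‖ ≤ M := by
  obtain ⟨M, hM⟩ := (isCompact_Icc (a := (0 : ℝ≥0)) (b := T)).exists_bound_of_continuousOn
    hf.continuousOn
  refine ⟨M, fun π t h0 => ?_⟩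
  rcases lt_or_ge t T with ht | ht
  · obtain ⟨s, hs1, -, hs⟩ := π.exists_step_eq f h0 ht
    rw [hs]
    exact hM s ⟨zero_le, NNReal.coe_le_coe.1 (hs1.trans ht.le)⟩
  · rw [π.step_of_le f ht, norm_zero]
    exact (norm_nonneg _).trans (hM 0 ⟨le_rfl, zero_le⟩)

theorem TimePartition.stronglyMeasurable_step {F : Type*} [NormedAddCommGroup F] (f : ℝ≥0 → F) :
    StronglyMeasurable (π.step f) := by
  unfold TimePartition.step
  refine Finset.stronglyMeasurable_fun_sum _ fun k _ => ?_
  exact (StronglyMeasurable.ite measurableSet_Iio stronglyMeasurable_const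
    stronglyMeasurable_const).sub (StronglyMeasurable.ite measurableSet_Iio
    stronglyMeasurable_const stronglyMeasurable_const)

theorem TimePartition.exists_mesh_tendsto_zero (T : ℝ≥0) :
    ∃ π : ℕ → TimePartition T, Tendsto (fun n => (π n).mesh) atTop (𝓝 0) := by
  refine ⟨fun n => ⟨n + 1, fun k => k * (T / (n + 1)), ?_, by simp, ?_⟩, ?_⟩
  · intro a b hab
    dsimp only
    gcongr
  · push_cast
    field_simp
  · have h : Tendsto (fun n : ℕ => T / ((n : ℝ≥0) + 1)) atTop (𝓝 0) := by
      rw [← NNReal.tendsto_coe]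
      push_cast
      simpa [div_eq_mul_inv] using
        (tendsto_one_div_add_atTop_nhds_zero_nat (𝕜 := ℝ)).const_mul (T : ℝ)
    refine tendsto_of_tendsto_of_tendsto_of_le_of_le tendsto_const_nhds h (fun _ => zero_le)
      fun n => Finset.sup_le fun k _ => ?_
    rw [tsub_le_iff_left]
    push_cast
    exact le_of_eq (by ring)

end Partition

/-! ### Characteristic functions of Riemann–Stieltjes sums -/

section CharFun

variable {Ω E : Type*} [MeasurableSpace Ω] {P : Measure Ω}
  [NormedAddCommGroup E] [InnerProductSpace ℝ E] [FiniteDimensional ℝ E]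
  [MeasurableSpace E] [BorelSpace E] {L : ℝ≥0 → Ω → E} {φ : E → ℝ}

/-- Sums of operators applied to the successive increments: the factors are independent and
stationarity reduces each to the law of `L` at the length of the step. -/
theorem IsLevyProcess.charFun_sum_increments (hL : IsLevyProcess L P)
    (hφ : ∀ (t : ℝ≥0) u, charFun (P.map (L t)) u = Complex.exp (-((t * φ u : ℝ) : ℂ)))
    {r : ℕ → ℝ≥0} (hr : Monotone r) (W : ℕ → E →L[ℝ] E) (n : ℕ) (u : E) :
    charFun (P.map fun ω => ∑ k ∈ Finset.range n, W k (L (r (k + 1)) ω - L (r k) ω)) u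
      = Complex.exp (-((∑ k ∈ Finset.range n,
          ((r (k + 1) : ℝ) - r k) * φ ((W k).adjoint u) : ℝ) : ℂ)) := by
  have hm : ∀ k, Measurable fun ω => L (r (k + 1)) ω - L (r k) ω := fun k =>
    (hL.measurable _).sub (hL.measurable _)
  have hind : iIndepFun (fun k ω => W k (L (r (k + 1)) ω - L (r k) ω)) P :=
    (hL.indep_increments.nat hr).comp (fun k => W k) fun k => (W k).measurable
  rw [iIndepFun.charFun_map_fun_finsetSum_eq_prod
    (X := fun k ω => W k (L (r (k + 1)) ω - L (r k) ω))
    (fun k _ => ((W k).measurable.comp (hm k)).aemeasurable) (hind.restrict _)]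
  rw [Finset.prod_apply, Complex.ofReal_sum, ← Finset.sum_neg_distrib, Complex.exp_sum]
  refine Finset.prod_congr rfl fun k _ => ?_
  have hst := hL.stationary_increments (r k) (r (k + 1) - r k)
  rw [add_tsub_cancel_of_le (hr k.le_succ)] at hst
  have hmap : P.map (fun ω => W k (L (r (k + 1)) ω - L (r k) ω))
      = (P.map fun ω => L (r (k + 1)) ω - L (r k) ω).map (W k) := by
    rw [Measure.map_map (W k).measurable (hm k)]
    rfl
  rw [hmap, charFun_map_continuousLinearMap, hst.map_eq, hφ, NNReal.coe_sub (hr k.le_succ)]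

/-- The integral of `φ` along a sum of nested indicators: the sum is constant, equal to the tail sum
of the `C j`, on each step. That `φ 0 = 0` makes the part beyond the last time vanish. -/
theorem integral_step_sum {E : Type*} [AddCommMonoid E] {φ : E → ℝ} {r : ℕ → ℝ≥0}
    (hr : Monotone r) (h0 : r 0 = 0) (C : ℕ → E) (n : ℕ) (hφ0 : φ 0 = 0) :
    ∫ t in Set.Ioi (0 : ℝ), φ (∑ k ∈ Finset.range n, if t < r (k + 1) then C k else 0)
      = ∑ k ∈ Finset.range n, ((r (k + 1) : ℝ) - r k) * φ (∑ j ∈ Finset.Ico k n, C j) := by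
  have hr' : Monotone fun k => (r k : ℝ) := fun a b h => NNReal.coe_le_coe.2 (hr h)
  have key : ∀ t ∈ Set.Ioi (0 : ℝ),
      φ (∑ k ∈ Finset.range n, if t < r (k + 1) then C k else 0)
      = ∑ k ∈ Finset.range n, (Set.Ico (r k : ℝ) (r (k + 1))).indicator
          (fun _ => φ (∑ j ∈ Finset.Ico k n, C j)) t := by
    intro t ht
    rcases lt_or_ge t (r n : ℝ) with htn | htn
    · obtain ⟨k, hk, hk1, hk2⟩ := exists_mem_Ico_of_monotone (r := fun k => (r k : ℝ))
        (n := n) (t := t) (by simpa [h0] using (le_of_lt ht)) htn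
      rw [Finset.sum_eq_single_of_mem (f := fun k => (Set.Ico (r k : ℝ) (r (k + 1))).indicator
        (fun _ => φ (∑ j ∈ Finset.Ico k n, C j)) t) k (Finset.mem_range.2 hk),
        Set.indicator_of_mem (Set.mem_Ico.2 ⟨hk1, hk2⟩)]
      · congr 1
        rw [← Finset.sum_filter]
        refine Finset.sum_congr ?_ fun _ _ => rfl
        ext j
        simp only [Finset.mem_filter, Finset.mem_range, Finset.mem_Ico]
        refine ⟨fun ⟨h1, h2⟩ => ⟨?_, h1⟩, fun ⟨h1, h2⟩ => ⟨h2, hk2.trans_le (hr' (by omega))⟩⟩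
        by_contra! hlt
        exact absurd (h2.trans_le ((hr' hlt).trans hk1)) (lt_irrefl _)
      · intro j _ hj
        refine Set.indicator_of_notMem (fun hmem => ?_) _
        rcases lt_or_gt_of_ne hj with hj | hj
        · exact absurd (hmem.2.trans_le ((hr' hj).trans hk1)) (lt_irrefl _)
        · exact absurd (hk2.trans_le ((hr' hj).trans hmem.1)) (lt_irrefl _)
    · rw [Finset.sum_eq_zero, hφ0, Finset.sum_eq_zero]
      · intro k hk
        refine Set.indicator_of_notMem (fun hmem => ?_) _
        exact absurd (hmem.2.trans_le ((hr' (Finset.mem_range.1 hk)).trans htn)) (lt_irrefl _)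
      · intro k hk
        exact if_neg ((hr' (Finset.mem_range.1 hk)).trans htn).not_gt
  rw [setIntegral_congr_fun measurableSet_Ioi key, integral_finsetSum]
  · refine Finset.sum_congr rfl fun k _ => ?_
    rw [← integral_Ici_eq_integral_Ioi, integral_indicator measurableSet_Ico,
      Measure.restrict_restrict measurableSet_Ico, Set.inter_eq_left.2, setIntegral_const]
    · simp [Measure.real, hr k.le_succ]
    · intro x hx
      exact (r k).2.trans hx.1
  · intro k _
    refine Integrable.integrableOn ?_
    rw [integrable_indicator_iff measurableSet_Ico]
    exact integrableOn_const (by simp)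

/-- Summation by parts turns a combination of values at increasing times into one of increments,
with the tail sums of the coefficients. -/
theorem IsLevyProcess.charFun_sum_of_monotone (hL : IsLevyProcess L P)
    (hφ : ∀ (t : ℝ≥0) u, charFun (P.map (L t)) u = Complex.exp (-((t * φ u : ℝ) : ℂ)))
    (hφ0 : φ 0 = 0) {r : ℕ → ℝ≥0} (hr : Monotone r) (h0 : r 0 = 0) (C : ℕ → E →L[ℝ] E) (n : ℕ)
    (u : E) :
    charFun (P.map fun ω => ∑ k ∈ Finset.range n, C k (L (r (k + 1)) ω)) u
      = Complex.exp (-((∫ t in Set.Ioi (0 : ℝ), φ (ContinuousLinearMap.adjoint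
        (∑ k ∈ Finset.range n, if t < r (k + 1) then C k else 0) u) : ℝ) : ℂ)) := by
  have hae : (fun ω => ∑ k ∈ Finset.range n, C k (L (r (k + 1)) ω)) =ᵐ[P]
      fun ω => ∑ k ∈ Finset.range n,
        (∑ j ∈ Finset.Ico k n, C j) (L (r (k + 1)) ω - L (r k) ω) := by
    filter_upwards [hL.start_zero] with ω hω
    simp_rw [_root_.sum_apply]
    rw [Finset.sum_comm' (t' := Finset.range n) (s' := fun j => Finset.range (j + 1))]
    · refine Finset.sum_congr rfl fun j _ => ?_
      rw [← map_sum, Finset.sum_range_sub fun k => L (r k) ω, h0, hω, sub_zero]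
    · intro k j
      simp only [Finset.mem_range, Finset.mem_Ico]
      omega
  have hadj : ∀ t : ℝ, ContinuousLinearMap.adjoint
        (∑ k ∈ Finset.range n, if t < r (k + 1) then C k else 0) u
      = ∑ k ∈ Finset.range n, if t < r (k + 1) then (C k).adjoint u else 0 := by
    intro t
    rw [map_sum, _root_.sum_apply]
    refine Finset.sum_congr rfl fun k _ => ?_
    split_ifs <;> simp
  rw [Measure.map_congr hae, hL.charFun_sum_increments hφ hr]
  simp_rw [hadj]
  rw [integral_step_sum hr h0 _ n hφ0]
  simp [map_sum]

/-- The characteristic function of a linear combination of values of `L`, in a form that does not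
refer to an ordering of the times. -/
theorem IsLevyProcess.charFun_sum (hL : IsLevyProcess L P)
    (hφ : ∀ (t : ℝ≥0) u, charFun (P.map (L t)) u = Complex.exp (-((t * φ u : ℝ) : ℂ)))
    (hφ0 : φ 0 = 0) {ι : Type*} [Fintype ι] (r : ι → ℝ≥0) (C : ι → E →L[ℝ] E) (u : E) :
    charFun (P.map fun ω => ∑ i, C i (L (r i) ω)) u
      = Complex.exp (-((∫ t in Set.Ioi (0 : ℝ), φ (ContinuousLinearMap.adjoint
        (∑ i, if t < r i then C i else 0) u) : ℝ) : ℂ)) := by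
  classical
  -- enumerate the index set so that the times increase
  let e₀ : Fin (Fintype.card ι) ≃ ι := (Fintype.equivFin ι).symm
  let e : Fin (Fintype.card ι) ≃ ι := (Tuple.sort (r ∘ e₀)).trans e₀
  have hmono : Monotone fun k => r (e k) := Tuple.monotone_sort (r ∘ e₀)
  let R : ℕ → ℝ≥0 := fun k => k.casesOn 0 fun k =>
    if h : k < Fintype.card ι then r (e ⟨k, h⟩) else ∑ i, r i
  let D : ℕ → E →L[ℝ] E := fun k => if h : k < Fintype.card ι then C (e ⟨k, h⟩) else 0
  have hR1 : ∀ k, R (k + 1) = if h : k < Fintype.card ι then r (e ⟨k, h⟩) else ∑ i, r i :=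
    fun k => rfl
  have hR : Monotone R := by
    refine monotone_nat_of_le_succ fun k => ?_
    cases k with
    | zero => exact zero_le
    | succ k =>
      rw [hR1, hR1]
      split_ifs with h1 h2 h2
      · exact hmono (Fin.mk_le_mk.2 k.le_succ)
      · exact Finset.single_le_sum (f := r) (fun _ _ => zero_le) (Finset.mem_univ _)
      · omega
      · exact le_rfl
  have h := hL.charFun_sum_of_monotone hφ hφ0 hR rfl D (Fintype.card ι) u
  have hRe : ∀ k : Fin (Fintype.card ι), R (k + 1) = r (e k) := fun k => by simp [hR1]
  have hDe : ∀ k : Fin (Fintype.card ι), D k = C (e k) := fun k => by simp [D]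
  simp_rw [Finset.sum_range, hRe, hDe] at h
  have h1 : ∀ ω, ∑ k, C (e k) (L (r (e k)) ω) = ∑ i, C i (L (r i) ω) := fun ω =>
    e.sum_comp fun i => C i (L (r i) ω)
  have h2 : ∀ t : ℝ, (∑ k, if t < r (e k) then C (e k) else 0) = ∑ i, if t < r i then C i else 0 :=
    fun t => e.sum_comp fun i => if t < r i then C i else 0
  simp_rw [h1, h2] at h
  exact h

/-- The difference of two Riemann–Stieltjes sums, over unrelated partitions of possibly different
intervals, has the exponent of the difference of the two step functions. -/
theorem IsLevyProcess.charFun_riemannSum_sub (hL : IsLevyProcess L P)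
    (hφ : ∀ (t : ℝ≥0) u, charFun (P.map (L t)) u = Complex.exp (-((t * φ u : ℝ) : ℂ)))
    (hφ0 : φ 0 = 0) {S T : ℝ≥0} (π : TimePartition T) (ρ : TimePartition S)
    (f : ℝ≥0 → E →L[ℝ] E) (u : E) :
    charFun (P.map (π.riemannSum f L - ρ.riemannSum f L)) u
      = Complex.exp (-((∫ t in Set.Ioi (0 : ℝ), φ (ContinuousLinearMap.adjoint
        (π.step f t - ρ.step f t) u) : ℝ) : ℂ)) := by
  have h := hL.charFun_sum hφ hφ0
    (Sum.elim
      (Sum.elim (fun k : Fin π.size => π.point (k + 1)) (fun k : Fin π.size => π.point k))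
      (Sum.elim (fun k : Fin ρ.size => ρ.point (k + 1)) (fun k : Fin ρ.size => ρ.point k)))
    (Sum.elim
      (Sum.elim (fun k : Fin π.size => f (π.point k)) (fun k : Fin π.size => -f (π.point k)))
      (Sum.elim (fun k : Fin ρ.size => -f (ρ.point k)) (fun k : Fin ρ.size => f (ρ.point k)))) u
  simp only [Fintype.sum_sum_type, Sum.elim_inl, Sum.elim_inr, _root_.neg_apply,
    Finset.sum_neg_distrib] at h
  have aux : ∀ a b c d : E, a - b - (c - d) = a + -b + (-c + d) := fun a b c d => by abel
  have hneg : ∀ (t : ℝ) (n : ℕ) (p : Fin n → ℝ≥0) (A : Fin n → E →L[ℝ] E),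
      (∑ k, if t < p k then -A k else 0) = -∑ k, if t < p k then A k else 0 := by
    intro t n p A
    rw [← Finset.sum_neg_distrib]
    refine Finset.sum_congr rfl fun k _ => ?_
    split_ifs <;> simp
  have h1 : (π.riemannSum f L - ρ.riemannSum f L) = fun ω =>
      ∑ k : Fin π.size, f (π.point k) (L (π.point (k + 1)) ω)
        + -∑ k : Fin π.size, f (π.point k) (L (π.point k) ω)
        + (-∑ k : Fin ρ.size, f (ρ.point k) (L (ρ.point (k + 1)) ω)
        + ∑ k : Fin ρ.size, f (ρ.point k) (L (ρ.point k) ω)) := by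
    ext ω
    simp only [Pi.sub_apply, TimePartition.riemannSum, map_sub, Finset.sum_sub_distrib,
      Finset.sum_range]
    exact aux _ _ _ _
  have h2 : ∀ t : ℝ, π.step f t - ρ.step f t =
      (∑ k : Fin π.size, if t < π.point (k + 1) then f (π.point k) else 0)
        + (∑ k : Fin π.size, if t < π.point k then -f (π.point k) else 0)
        + ((∑ k : Fin ρ.size, if t < ρ.point (k + 1) then -f (ρ.point k) else 0)
        + ∑ k : Fin ρ.size, if t < ρ.point k then f (ρ.point k) else 0) := by
    intro t
    rw [hneg, hneg]
    simp only [TimePartition.step, Finset.sum_sub_distrib, Finset.sum_range]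
    abel
  simp_rw [h1, h2]
  exact h

theorem TimePartition.measurable_riemannSum (hL : IsLevyProcess L P) {T : ℝ≥0}
    (π : TimePartition T) (f : ℝ≥0 → E →L[ℝ] E) : Measurable (π.riemannSum f L) :=
  Finset.measurable_fun_sum _ fun _ _ => (ContinuousLinearMap.measurable _).comp
    ((hL.measurable _).sub (hL.measurable _))

/-- The law of the difference of Riemann–Stieltjes sums over `[0, T]` and `[0, S]` as the meshes
tend to `0`. For `S = T` the limit is `1`, which gives the Cauchy property; different end points
give the law of the integral between them. -/
theorem IsLevyProcess.tendsto_charFun_riemannSum_sub (hL : IsLevyProcess L P)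
    (hφ : ∀ (t : ℝ≥0) u, charFun (P.map (L t)) u = Complex.exp (-((t * φ u : ℝ) : ℂ)))
    (hφ0 : φ 0 = 0) (hφc : Continuous φ) {f : ℝ≥0 → E →L[ℝ] E} (hf : Continuous f)
    {ι : Type*} {l : Filter ι} [l.IsCountablyGenerated] {S T : ℝ≥0}
    {π : ι → TimePartition T} (hπ : Tendsto (fun i => (π i).mesh) l (𝓝 0))
    {ρ : ι → TimePartition S} (hρ : Tendsto (fun i => (ρ i).mesh) l (𝓝 0)) (u : E) :
    Tendsto (fun i => charFun (P.map ((π i).riemannSum f L - (ρ i).riemannSum f L)) u) l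
      (𝓝 (Complex.exp (-((∫ t in Set.Ioi (0 : ℝ), φ (ContinuousLinearMap.adjoint
        ((if t < T then f t.toNNReal else 0) - if t < S then f t.toNNReal else 0) u) : ℝ)
          : ℂ)))) := by
  simp_rw [hL.charFun_riemannSum_sub hφ hφ0]
  refine (Complex.continuous_exp.tendsto _).comp
    (((Complex.continuous_ofReal.tendsto _).comp ?_).neg)
  have hcont : Continuous fun A : E →L[ℝ] E => φ (ContinuousLinearMap.adjoint A u) :=
    hφc.comp ((ContinuousLinearMap.adjoint.continuous).clm_apply continuous_const)
  obtain ⟨M, hM⟩ := TimePartition.exists_norm_step_le hf T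
  obtain ⟨N, hN⟩ := TimePartition.exists_norm_step_le hf S
  obtain ⟨B, hB⟩ := (isCompact_closedBall (0 : E →L[ℝ] E) (M + N)).exists_bound_of_continuousOn
    hcont.continuousOn
  refine tendsto_integral_filter_of_dominated_convergence
    ((Set.Ico (0 : ℝ) (max T S)).indicator fun _ => B) ?_ ?_ ?_ ?_
  · refine Eventually.of_forall fun i =>
      (hcont.comp_stronglyMeasurable (StronglyMeasurable.sub ?_ ?_)).aestronglyMeasurable
    · exact (π i).stronglyMeasurable_step f
    · exact (ρ i).stronglyMeasurable_step f
  · refine Eventually.of_forall fun i => (ae_restrict_iff' measurableSet_Ioi).2 ?_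
    refine Eventually.of_forall fun t ht => ?_
    have ht0 : 0 ≤ t := le_of_lt ht
    rcases lt_or_ge t (max T S : ℝ) with h | h
    · rw [Set.indicator_of_mem (Set.mem_Ico.2 ⟨ht0, h⟩)]
      refine hB _ (mem_closedBall_zero_iff.2 ((norm_sub_le _ _).trans ?_))
      exact add_le_add (hM _ t ht0) (hN _ t ht0)
    · rw [Set.indicator_of_notMem (fun h' => absurd (Set.mem_Ico.1 h').2 h.not_gt),
        (π i).step_of_le f ((le_max_left _ _).trans h),
        (ρ i).step_of_le f ((le_max_right _ _).trans h)]
      simp [hφ0]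
  · refine Integrable.integrableOn ?_
    rw [integrable_indicator_iff measurableSet_Ico]
    exact integrableOn_const (by simp)
  · refine (ae_restrict_iff' measurableSet_Ioi).2 (Eventually.of_forall fun t ht => ?_)
    exact (hcont.tendsto _).comp ((TimePartition.tendsto_step hf hπ (le_of_lt ht)).sub
      (TimePartition.tendsto_step hf hρ (le_of_lt ht)))

end CharFun

/-! ### Existence and law of the improper integral -/

section Integral

variable {Ω E : Type*} [MeasurableSpace Ω] {P : Measure Ω}
  [NormedAddCommGroup E] [InnerProductSpace ℝ E] [FiniteDimensional ℝ E]
  {L : ℝ≥0 → Ω → E} {φ : E → ℝ} {f : ℝ≥0 → E →L[ℝ] E}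

/-- Dominated convergence for the exponent of the characteristic function of
`∫_S^T f(t) dL_t` when `T` and `S` vary. -/
theorem tendsto_integral_exponent (hφ0 : φ 0 = 0) (hφneg : ∀ u, φ (-u) = φ u)
    (hφc : Continuous φ) (hf : Continuous f) {u : E}
    (hint : IntegrableOn (fun t : ℝ => φ ((f t.toNNReal).adjoint u)) (Set.Ioi 0))
    {ι : Type*} {l : Filter ι} [l.IsCountablyGenerated] {T S : ι → ℝ≥0} {g : ℝ → ℝ}
    (hg : ∀ t : ℝ, 0 < t → ∀ᶠ i in l, φ (ContinuousLinearMap.adjoint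
      ((if t < T i then f t.toNNReal else 0) - if t < S i then f t.toNNReal else 0) u) = g t) :
    Tendsto (fun i => Complex.exp (-((∫ t in Set.Ioi (0 : ℝ), φ (ContinuousLinearMap.adjoint
      ((if t < T i then f t.toNNReal else 0) - if t < S i then f t.toNNReal else 0) u) : ℝ) : ℂ)))
      l (𝓝 (Complex.exp (-((∫ t in Set.Ioi (0 : ℝ), g t : ℝ) : ℂ)))) := by
  refine (Complex.continuous_exp.tendsto _).comp
    (((Complex.continuous_ofReal.tendsto _).comp ?_).neg)
  have hcont : Continuous fun A : E →L[ℝ] E => φ (ContinuousLinearMap.adjoint A u) :=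
    hφc.comp ((ContinuousLinearMap.adjoint.continuous).clm_apply continuous_const)
  have hfm : StronglyMeasurable fun t : ℝ => f t.toNNReal :=
    (hf.comp continuous_real_toNNReal).stronglyMeasurable
  have hm : ∀ R : ℝ≥0, StronglyMeasurable fun t : ℝ => if t < R then f t.toNNReal else 0 :=
    fun R => StronglyMeasurable.ite measurableSet_Iio hfm stronglyMeasurable_const
  refine tendsto_integral_filter_of_dominated_convergence
    (fun t => ‖φ ((f t.toNNReal).adjoint u)‖) ?_ ?_ hint.norm ?_
  · exact Eventually.of_forall fun i =>
      (hcont.comp_stronglyMeasurable ((hm _).sub (hm _))).aestronglyMeasurable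
  · refine Eventually.of_forall fun i => Eventually.of_forall fun t => ?_
    split_ifs <;> simp [hφ0, hφneg]
  · refine (ae_restrict_iff' measurableSet_Ioi).2 (Eventually.of_forall fun t ht => ?_)
    exact tendsto_const_nhds.congr' ((hg t ht).mono fun i hi => hi.symm)

variable [MeasurableSpace E] [BorelSpace E]

/-- The Riemann–Stieltjes sums along one sequence of partitions are Cauchy in probability, and those
along any other sequence are asymptotically equal to them. -/
theorem IsLevyProcess.exists_isLevyIntegral [IsProbabilityMeasure P] (hL : IsLevyProcess L P)
    (hφ : ∀ (t : ℝ≥0) u, charFun (P.map (L t)) u = Complex.exp (-((t * φ u : ℝ) : ℂ)))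
    (hφ0 : φ 0 = 0) (hφc : Continuous φ) (hf : Continuous f) (T : ℝ≥0) :
    ∃ Y, IsLevyIntegral P f L T Y := by
  have hzero : ∀ {ι : Type} (l : Filter ι) [l.IsCountablyGenerated] (π ρ : ι → TimePartition T),
      Tendsto (fun i => (π i).mesh) l (𝓝 0) → Tendsto (fun i => (ρ i).mesh) l (𝓝 0) →
      TendstoInMeasure P (fun i => (π i).riemannSum f L - (ρ i).riemannSum f L) l 0 := by
    intro ι l _ π ρ hπ hρ
    refine tendstoInMeasure_zero_of_charFun (fun i =>
      ((TimePartition.measurable_riemannSum hL (π i) f).sub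
        (TimePartition.measurable_riemannSum hL (ρ i) f)).aemeasurable) fun u => ?_
    simpa [hφ0] using hL.tendsto_charFun_riemannSum_sub hφ hφ0 hφc hf hπ hρ u
  obtain ⟨ρ, hρ⟩ := TimePartition.exists_mesh_tendsto_zero T
  obtain ⟨Y, hY⟩ := exists_tendstoInMeasure_of_cauchy (P := P) (l := atTop)
    (X := fun n => (ρ n).riemannSum f L)
    (fun n => (TimePartition.measurable_riemannSum hL (ρ n) f).aestronglyMeasurable)
    (hzero (atTop ×ˢ atTop) (fun p => ρ p.1) (fun p => ρ p.2)
      (hρ.comp tendsto_fst) (hρ.comp tendsto_snd))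
  refine ⟨Y, fun π hπ => ?_⟩
  have h := (hzero atTop π ρ hπ hρ).add hY
  simpa only [sub_add_cancel, zero_add] using h

theorem IsLevyIntegral.aemeasurable (hL : IsLevyProcess L P) {T : ℝ≥0} {Y : Ω → E}
    (hY : IsLevyIntegral P f L T Y) : AEMeasurable Y P := by
  obtain ⟨ρ, hρ⟩ := TimePartition.exists_mesh_tendsto_zero T
  exact (hY ρ hρ).aemeasurable fun n =>
    (TimePartition.measurable_riemannSum hL (ρ n) f).aemeasurable

theorem isLevyIntegral_zero {E : Type*} [NormedAddCommGroup E] [NormedSpace ℝ E]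
    {L : ℝ≥0 → Ω → E} {f : ℝ≥0 → E →L[ℝ] E} : IsLevyIntegral P f L 0 (0 : Ω → E) := by
  intro π _
  have h : ∀ n, (π n).riemannSum f L = 0 := by
    intro n
    ext ω
    refine Finset.sum_eq_zero fun k hk => ?_
    have h1 := le_antisymm ((π n).point_le (Finset.mem_range.1 hk)) zero_le
    have h2 := le_antisymm ((π n).point_le (Finset.mem_range.1 hk).le) zero_le
    rw [h1, h2, sub_self, map_zero]
  simp_rw [h]
  intro ε hε
  simp [hε.ne']

theorem IsLevyIntegral.charFun_sub [IsProbabilityMeasure P] (hL : IsLevyProcess L P)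
    (hφ : ∀ (t : ℝ≥0) u, charFun (P.map (L t)) u = Complex.exp (-((t * φ u : ℝ) : ℂ)))
    (hφ0 : φ 0 = 0) (hφc : Continuous φ) (hf : Continuous f) {S T : ℝ≥0} {Y Z : Ω → E}
    (hY : IsLevyIntegral P f L T Y) (hZ : IsLevyIntegral P f L S Z) (u : E) :
    charFun (P.map (Y - Z)) u = Complex.exp (-((∫ t in Set.Ioi (0 : ℝ),
      φ (ContinuousLinearMap.adjoint ((if t < (T : ℝ) then f t.toNNReal else 0)
        - if t < S then f t.toNNReal else 0) u) : ℝ) : ℂ)) := by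
  obtain ⟨π, hπ⟩ := TimePartition.exists_mesh_tendsto_zero T
  obtain ⟨ρ, hρ⟩ := TimePartition.exists_mesh_tendsto_zero S
  have h := ((hY π hπ).sub (hZ ρ hρ)).tendsto_charFun (fun n =>
    ((TimePartition.measurable_riemannSum hL (π n) f).sub
      (TimePartition.measurable_riemannSum hL (ρ n) f)).aemeasurable) u
  exact tendsto_nhds_unique h (hL.tendsto_charFun_riemannSum_sub hφ hφ0 hφc hf hπ hρ u)

/-- The integrals `∫₀ᵀ f dL` are Cauchy in probability as `T → ∞` if the exponent is integrable
along `f`. -/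
theorem IsLevyProcess.exists_isImproperLevyIntegral [IsProbabilityMeasure P] (hL : IsLevyProcess L P)
    (hφ : ∀ (t : ℝ≥0) u, charFun (P.map (L t)) u = Complex.exp (-((t * φ u : ℝ) : ℂ)))
    (hφ0 : φ 0 = 0) (hφneg : ∀ u, φ (-u) = φ u) (hφc : Continuous φ) (hf : Continuous f)
    (hint : ∀ u, IntegrableOn (fun t : ℝ => φ ((f t.toNNReal).adjoint u)) (Set.Ioi 0)) :
    ∃ X, IsImproperLevyIntegral P f L X := by
  choose Y hY using hL.exists_isLevyIntegral hφ hφ0 hφc hf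
  have hYm : ∀ T, AEMeasurable (Y T) P := fun T => (hY T).aemeasurable hL
  obtain ⟨X, hX⟩ := exists_tendstoInMeasure_of_cauchy (P := P) (l := atTop) (X := Y)
    (fun T => (hYm T).aestronglyMeasurable) (by
      refine tendstoInMeasure_zero_of_charFun (fun p => (hYm p.1).sub (hYm p.2)) fun u => ?_
      simp_rw [(hY _).charFun_sub hL hφ hφ0 hφc hf (hY _)]
      have h := tendsto_integral_exponent hφ0 hφneg hφc hf (hint u)
        (l := (atTop : Filter ℝ≥0) ×ˢ (atTop : Filter ℝ≥0)) (T := Prod.fst) (S := Prod.snd)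
        (g := fun _ => 0) fun t ht => by
          filter_upwards [tendsto_fst.eventually (eventually_gt_atTop t.toNNReal),
            tendsto_snd.eventually (eventually_gt_atTop t.toNNReal)] with p h1 h2
          rw [if_pos ((Real.toNNReal_lt_iff_lt_coe ht.le).1 h1),
            if_pos ((Real.toNNReal_lt_iff_lt_coe ht.le).1 h2)]
          simp [hφ0]
      simpa using h)
  exact ⟨X, Y, hY, hX⟩

theorem IsImproperLevyIntegral.aemeasurable (hL : IsLevyProcess L P) {X : Ω → E}
    (hX : IsImproperLevyIntegral P f L X) : AEMeasurable X P := by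
  obtain ⟨Y, hY, hYX⟩ := hX
  exact hYX.aemeasurable fun T => (hY T).aemeasurable hL

theorem IsImproperLevyIntegral.charFun_eq [IsProbabilityMeasure P] (hL : IsLevyProcess L P)
    (hφ : ∀ (t : ℝ≥0) u, charFun (P.map (L t)) u = Complex.exp (-((t * φ u : ℝ) : ℂ)))
    (hφ0 : φ 0 = 0) (hφneg : ∀ u, φ (-u) = φ u) (hφc : Continuous φ) (hf : Continuous f) {u : E}
    (hint : IntegrableOn (fun t : ℝ => φ ((f t.toNNReal).adjoint u)) (Set.Ioi 0)) {X : Ω → E}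
    (hX : IsImproperLevyIntegral P f L X) :
    charFun (P.map X) u = Complex.exp (-((∫ t in Set.Ioi (0 : ℝ),
      φ ((f t.toNNReal).adjoint u) : ℝ) : ℂ)) := by
  obtain ⟨Y, hY, hYX⟩ := hX
  have h1 := hYX.tendsto_charFun (fun T => (hY T).aemeasurable hL) u
  refine tendsto_nhds_unique h1 ?_
  have h2 := fun T => (hY T).charFun_sub hL hφ hφ0 hφc hf isLevyIntegral_zero u
  simp only [sub_zero] at h2
  simp_rw [h2]
  refine tendsto_integral_exponent hφ0 hφneg hφc hf hint (T := id) (S := fun _ => 0) fun t ht => ?_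
  filter_upwards [eventually_gt_atTop t.toNNReal] with T hT
  have hT' : t < (id T : ℝ≥0) := (Real.toNNReal_lt_iff_lt_coe ht.le).1 hT
  have h0 : ¬ t < ((0 : ℝ≥0) : ℝ) := by simpa using ht.le
  rw [if_pos hT', if_neg h0, sub_zero]

end Integral

/-! ### Comparison of the scales in an eigenbasis -/

section Scalar

variable {ι : Type*} [Fintype ι] {w l : ι → ℝ} {p : ℝ}

/-- The integrand is dominated by a multiple of `exp(-2 p δ t)`, where `δ` is the least of the
rates `l i`. -/
theorem integrableOn_rpow_sum_exp (hw : ∀ i, 0 ≤ w i) (hl : ∀ i, 0 < l i) (hp : 0 < p) :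
    IntegrableOn (fun t : ℝ => (∑ i, w i * Real.exp (-(t * l i)) ^ 2) ^ p) (Set.Ioi 0) := by
  obtain ⟨δ, hδ, hδl⟩ : ∃ δ > 0, ∀ i, δ ≤ l i := by
    rcases isEmpty_or_nonempty ι with h | h
    · exact ⟨1, one_pos, fun i => isEmptyElim i⟩
    · obtain ⟨i, hi⟩ := Finite.exists_min l
      exact ⟨l i, hl i, hi⟩
  have hexp := (integrableOn_exp_mul_Ioi (a := -(2 * p * δ)) (by nlinarith [mul_pos hp hδ])
    0).const_mul ((∑ i, w i) ^ p)
  refine Integrable.mono' hexp ?_ ((ae_restrict_iff' measurableSet_Ioi).2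
    (Eventually.of_forall fun t ht => ?_))
  · refine Continuous.aestronglyMeasurable ?_
    exact Continuous.rpow_const (by fun_prop) fun _ => Or.inr hp.le
  · have h0 : 0 ≤ ∑ i, w i * Real.exp (-(t * l i)) ^ 2 :=
      Finset.sum_nonneg fun i _ => mul_nonneg (hw i) (sq_nonneg _)
    have hW : 0 ≤ ∑ i, w i := Finset.sum_nonneg fun i _ => hw i
    rw [Real.norm_of_nonneg (Real.rpow_nonneg h0 _)]
    have hle : ∑ i, w i * Real.exp (-(t * l i)) ^ 2 ≤ (∑ i, w i) * Real.exp (-(2 * δ) * t) := by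
      rw [Finset.sum_mul]
      refine Finset.sum_le_sum fun i _ => mul_le_mul_of_nonneg_left ?_ (hw i)
      rw [← Real.exp_nat_mul]
      refine Real.exp_le_exp.2 ?_
      have := mul_le_mul_of_nonneg_left (hδl i) (le_of_lt ht)
      push_cast
      linarith
    refine (Real.rpow_le_rpow h0 hle hp.le).trans_eq ?_
    rw [Real.mul_rpow hW (Real.exp_pos _).le, ← Real.exp_mul]
    congr 2
    ring

/-- The scale of the Polyak–Ruppert average is at most that of the final iterate, in an eigenbasis
of the Hessian with eigenvalues `h i`: Jensen's inequality reduces the claim to one dimension, where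
it is Bernoulli's inequality. -/
theorem rpow_sum_inv_sq_le_integral {α c : ℝ} {h : ι → ℝ} (hα₁ : 1 < α) (hα₂ : α < 2) (hc : 0 < c)
    (hw : ∀ i, 0 ≤ w i) (hh : ∀ i, 0 < h i) (hcH : ∀ i, (1 - α⁻¹) / c < h i) :
    (∑ i, w i * (h i)⁻¹ ^ 2) ^ (α / 2) ≤ c ^ (α - 1) * ∫ t in Set.Ioi (0 : ℝ),
      (∑ i, w i * Real.exp (-(t * (h i - (1 - α⁻¹) / c))) ^ 2) ^ (α / 2) := by
  have hα : 0 < α := by linarith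
  set l : ι → ℝ := fun i => h i - (1 - α⁻¹) / c with hl_def
  have hl : ∀ i, 0 < l i := fun i => sub_pos.2 (hcH i)
  set A : ℝ := ∑ i, w i * (h i)⁻¹ ^ 2 with hA
  have hA0 : 0 ≤ A := Finset.sum_nonneg fun i _ => mul_nonneg (hw i) (sq_nonneg _)
  have hint := integrableOn_rpow_sum_exp hw hl (half_pos hα)
  -- for `A = 0` the probability weights below are undefined, but the left side vanishes
  rcases hA0.eq_or_lt with hA0' | hApos
  · rw [← hA0', Real.zero_rpow (by positivity)]
    refine mul_nonneg (Real.rpow_nonneg hc.le _) (integral_nonneg fun t => Real.rpow_nonneg ?_ _)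
    exact Finset.sum_nonneg fun i _ => mul_nonneg (hw i) (sq_nonneg _)
  -- the contributions of the eigendirections to `A`, as probability weights
  set q : ι → ℝ := fun i => w i * (h i)⁻¹ ^ 2 / A with hq
  have hq0 : ∀ i, 0 ≤ q i := fun i => div_nonneg (mul_nonneg (hw i) (sq_nonneg _)) hA0
  have hq1 : ∑ i, q i = 1 := by
    rw [← Finset.sum_div, ← hA, div_self hApos.ne']
  -- one-dimensional comparison: Bernoulli's inequality
  have hone : ∀ i, 1 ≤ c ^ (α - 1) * (h i ^ α * (α * l i)⁻¹) := by
    intro i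
    have hb := one_add_mul_self_le_rpow_one_add (s := c * h i - 1)
      (by have := mul_pos hc (hh i); linarith) hα₁.le
    rw [add_sub_cancel, Real.mul_rpow hc.le (hh i).le] at hb
    have hlc : 1 + α * (c * h i - 1) = c * (α * l i) := by
      simp only [hl_def]
      field_simp
      ring
    rw [hlc] at hb
    have hpos : 0 < α * l i := mul_pos hα (hl i)
    rw [← mul_assoc, ← div_eq_mul_inv, le_div_iff₀ hpos, one_mul, Real.rpow_sub_one hc.ne',
      div_mul_eq_mul_div, le_div_iff₀ hc]
    linarith
  -- Jensen's inequality for the concave function `x ↦ x ^ (α / 2)`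
  have hpt : ∀ t : ℝ, ∑ i, q i * (A ^ (α / 2) * (h i ^ α * Real.exp (-(α * l i) * t)))
      ≤ (∑ i, w i * Real.exp (-(t * l i)) ^ 2) ^ (α / 2) := by
    intro t
    have hJ := (Real.concaveOn_rpow (p := α / 2) (by positivity) (by linarith)).le_map_sum
      (t := Finset.univ) (w := q) (p := fun i => A * (h i ^ 2 * Real.exp (-(t * l i)) ^ 2))
      (fun i _ => hq0 i) hq1 (fun i _ => by have := (hh i).le; simp only [Set.mem_Ici]; positivity)
    simp only [smul_eq_mul] at hJ
    have e1 : ∀ i, (A * (h i ^ 2 * Real.exp (-(t * l i)) ^ 2)) ^ (α / 2)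
        = A ^ (α / 2) * (h i ^ α * Real.exp (-(α * l i) * t)) := by
      intro i
      rw [Real.mul_rpow hA0 (by positivity), Real.mul_rpow (by positivity) (by positivity),
        ← Real.rpow_natCast_mul (hh i).le, ← Real.exp_nat_mul, ← Real.exp_mul]
      congr 3
      · push_cast; ring
      · push_cast; ring
    have e2 : ∀ i, q i * (A * (h i ^ 2 * Real.exp (-(t * l i)) ^ 2))
        = w i * Real.exp (-(t * l i)) ^ 2 := by
      intro i
      have := (hh i).ne'
      simp only [hq]
      field_simp
    simp_rw [e1, e2] at hJ
    exact hJ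
  have hexp : ∀ i, IntegrableOn (fun t : ℝ => Real.exp (-(α * l i) * t)) (Set.Ioi 0) := fun i =>
    integrableOn_exp_mul_Ioi (neg_lt_zero.2 (mul_pos hα (hl i))) 0
  have hterm : ∀ i, IntegrableOn
      (fun t : ℝ => q i * (A ^ (α / 2) * (h i ^ α * Real.exp (-(α * l i) * t)))) (Set.Ioi 0) :=
    fun i => (((hexp i).const_mul _).const_mul _).const_mul _
  have hval : ∀ i, ∫ t in Set.Ioi (0 : ℝ),
      q i * (A ^ (α / 2) * (h i ^ α * Real.exp (-(α * l i) * t)))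
      = q i * (A ^ (α / 2) * (h i ^ α * (α * l i)⁻¹)) := by
    intro i
    rw [integral_const_mul, integral_const_mul, integral_const_mul,
      integral_exp_mul_Ioi (neg_lt_zero.2 (mul_pos hα (hl i))) 0]
    simp [neg_div_neg_eq]
  have hmono := integral_mono (integrable_finsetSum _ fun i _ => hterm i) hint hpt
  rw [integral_finsetSum _ fun i _ => hterm i] at hmono
  simp_rw [hval] at hmono
  calc A ^ (α / 2) = ∑ i, q i * A ^ (α / 2) := by rw [← Finset.sum_mul, hq1, one_mul]
    _ ≤ ∑ i, q i * A ^ (α / 2) * (c ^ (α - 1) * (h i ^ α * (α * l i)⁻¹)) :=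
        Finset.sum_le_sum fun i _ => le_mul_of_one_le_right
          (mul_nonneg (hq0 i) (Real.rpow_nonneg hA0 _)) (hone i)
    _ = c ^ (α - 1) * ∑ i, q i * (A ^ (α / 2) * (h i ^ α * (α * l i)⁻¹)) := by
        rw [Finset.mul_sum]
        exact Finset.sum_congr rfl fun i _ => by ring
    _ ≤ _ := mul_le_mul_of_nonneg_left hmono (Real.rpow_nonneg hc.le _)

end Scalar

/-! ### Simultaneous diagonalization -/

section Spectral

open scoped MatrixOrder

variable {d : ℕ} {H S : Matrix (Fin d) (Fin d) ℝ}

/-- The functional calculus as an explicit product, conjugating a diagonal matrix by the eigenvector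
matrix. -/
theorem Matrix.IsHermitian.cfc_conj (hH : H.IsHermitian) (g : ℝ → ℝ) :
    hH.cfc g = (hH.eigenvectorUnitary : Matrix (Fin d) (Fin d) ℝ)
      * Matrix.diagonal (fun i => g (hH.eigenvalues i)) *
      star (hH.eigenvectorUnitary : Matrix (Fin d) (Fin d) ℝ) := by
  rw [Matrix.IsHermitian.cfc, Unitary.conjStarAlgAut_apply]
  rfl

theorem Matrix.IsHermitian.isHermitian_cfc (hH : H.IsHermitian) (g : ℝ → ℝ) :
    (hH.cfc g).IsHermitian := by
  rw [hH.cfc_conj, Matrix.star_eq_conjTranspose]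
  refine Matrix.isHermitian_mul_mul_conjTranspose _ ?_
  exact Matrix.isHermitian_diagonal _

theorem Matrix.IsHermitian.exp_eq_cfc (hH : H.IsHermitian) (t κ : ℝ) :
    NormedSpace.exp (-(t • (H - κ • (1 : Matrix (Fin d) (Fin d) ℝ))))
      = hH.cfc fun x => Real.exp (-(t * (x - κ))) := by
  have hlin : -(t • (H - κ • (1 : Matrix (Fin d) (Fin d) ℝ)))
      = hH.cfc fun x => -(t * (x - κ)) := by
    have hd : Matrix.diagonal (fun i => -(t * (hH.eigenvalues i - κ)))
        = -(t • (Matrix.diagonal (RCLike.ofReal ∘ hH.eigenvalues)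
          - κ • (1 : Matrix (Fin d) (Fin d) ℝ))) := by
      ext i j
      rcases eq_or_ne i j with rfl | hij <;> simp [*]
    rw [Matrix.IsHermitian.cfc]
    change _ = Unitary.conjStarAlgAut ℝ _ _
      (Matrix.diagonal (fun i => -(t * (hH.eigenvalues i - κ))))
    rw [hd]
    conv_lhs => rw [hH.spectral_theorem]
    rw [map_neg, map_smul, map_sub, map_smul, map_one]
  have hunit : IsUnit (hH.eigenvectorUnitary : Matrix (Fin d) (Fin d) ℝ) :=
    (Unitary.toUnits hH.eigenvectorUnitary).isUnit
  have hinv : star (hH.eigenvectorUnitary : Matrix (Fin d) (Fin d) ℝ)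
      = (hH.eigenvectorUnitary : Matrix (Fin d) (Fin d) ℝ)⁻¹ :=
    (Matrix.inv_eq_left_inv (Unitary.coe_star_mul_self _)).symm
  rw [hlin, hH.cfc_conj, hH.cfc_conj, hinv, Matrix.exp_conj _ _ hunit, Matrix.exp_diagonal]
  congr 3
  ext i
  simp [Real.exp_eq_exp_ℝ]

theorem Matrix.PosDef.inv_eq_cfc (hH : H.PosDef) :
    H⁻¹ = hH.isHermitian.cfc fun x => x⁻¹ := by
  refine Matrix.inv_eq_right_inv ?_
  conv_lhs => lhs; rw [hH.isHermitian.spectral_theorem]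
  rw [Matrix.IsHermitian.cfc, ← map_mul, Matrix.diagonal_mul_diagonal]
  have : (fun i => (RCLike.ofReal ∘ hH.isHermitian.eigenvalues) i *
      ((RCLike.ofReal : ℝ → ℝ) ∘ (fun x => x⁻¹) ∘ hH.isHermitian.eigenvalues) i) =
        fun _ => (1 : ℝ) := by
    ext i
    simp [(hH.eigenvalues_pos i).ne']
  rw [this, Matrix.diagonal_one, map_one]

/-- For all functions `g(H)` of `H` at once, the form `S` at `g(H) u` is `∑ᵢ wᵢ g(hᵢ)²` with
nonnegative weights. The square root `B` of `S` commutes with `g(H)`, so the form is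
`‖g(H) B u‖²`, and `wᵢ` is the square of the `i`-th coordinate of `B u` in an eigenbasis of `H`. -/
theorem Matrix.IsHermitian.exists_weights (hH : H.IsHermitian) (hS : S.PosSemidef)
    (hcomm : S * H = H * S) (u : Fin d → ℝ) :
    ∃ w : Fin d → ℝ, (∀ i, 0 ≤ w i) ∧ ∀ g : ℝ → ℝ,
      (hH.cfc g *ᵥ u) ⬝ᵥ S *ᵥ (hH.cfc g *ᵥ u) = ∑ i, w i * g (hH.eigenvalues i) ^ 2 := by
  set B := CFC.sqrt S with hB
  have hBB : B * B = S := CFC.sqrt_mul_sqrt_self S hS.nonneg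
  have hBH : Commute B H := by
    rw [hB, CFC.sqrt_eq_cfc]
    exact Commute.cfc_nnreal (show Commute S H from hcomm) _
  have hBsym : B.IsHermitian := (Matrix.nonneg_iff_posSemidef.1 (CFC.sqrt_nonneg S)).isHermitian
  set U : Matrix (Fin d) (Fin d) ℝ := (hH.eigenvectorUnitary : Matrix (Fin d) (Fin d) ℝ) with hU
  refine ⟨fun i => (star U *ᵥ (B *ᵥ u)) i ^ 2, fun i => sq_nonneg _, fun g => ?_⟩
  have hcommg : B * hH.cfc g = hH.cfc g * B := by
    have : Commute (hH.cfc g) B := by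
      rw [← hH.cfc_eq]
      exact hBH.symm.cfc_real g
    exact this.symm
  have hnorm : ∀ x y : Fin d → ℝ, x ⬝ᵥ S *ᵥ y = (B *ᵥ x) ⬝ᵥ (B *ᵥ y) := by
    intro x y
    rw [← hBB, ← Matrix.mulVec_mulVec, Matrix.dotProduct_mulVec, ← Matrix.mulVec_transpose]
    congr 2
  have hUnorm : ∀ x : Fin d → ℝ, (U *ᵥ x) ⬝ᵥ (U *ᵥ x) = x ⬝ᵥ x := by
    intro x
    rw [Matrix.dotProduct_mulVec, ← Matrix.mulVec_transpose, Matrix.mulVec_mulVec]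
    have : Uᵀ * U = 1 := Unitary.coe_star_mul_self hH.eigenvectorUnitary
    rw [this, Matrix.one_mulVec]
  rw [hnorm, Matrix.mulVec_mulVec, hcommg, ← Matrix.mulVec_mulVec, hH.cfc_conj,
    ← Matrix.mulVec_mulVec, ← Matrix.mulVec_mulVec, hUnorm]
  simp only [dotProduct, Matrix.mulVec_diagonal]
  exact Finset.sum_congr rfl fun i _ => by ring

end Spectral

/-! ### The elliptical exponent along the kernel of the final iterate -/

section Final

variable {d : ℕ} {H S : Matrix (Fin d) (Fin d) ℝ} {α c : ℝ}

/-- The characteristic exponent `(vᵀ S v)^(α/2)` of an elliptically contoured stable law. -/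
noncomputable def ellipticalExponent (S : Matrix (Fin d) (Fin d) ℝ) (α : ℝ)
    (v : EuclideanSpace ℝ (Fin d)) : ℝ :=
  (v.ofLp ⬝ᵥ S *ᵥ v.ofLp) ^ (α / 2)

theorem continuous_ellipticalExponent (hα : 0 < α) : Continuous (ellipticalExponent S α) := by
  refine Continuous.rpow_const ?_ fun _ => Or.inr (half_pos hα).le
  unfold dotProduct Matrix.mulVec dotProduct
  fun_prop

theorem ellipticalExponent_zero (hα : 0 < α) : ellipticalExponent S α 0 = 0 := by
  simp [ellipticalExponent, Real.zero_rpow (half_pos hα).ne']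

theorem ellipticalExponent_neg (v : EuclideanSpace ℝ (Fin d)) :
    ellipticalExponent S α (-v) = ellipticalExponent S α v := by
  simp [ellipticalExponent, Matrix.mulVec_neg]

theorem ellipticalExponent_smul (hS : S.PosSemidef) (r : ℝ) (v : EuclideanSpace ℝ (Fin d)) :
    ellipticalExponent S α (r • v) = |r| ^ α * ellipticalExponent S α v := by
  have hq : 0 ≤ v.ofLp ⬝ᵥ S *ᵥ v.ofLp := by
    simpa using hS.dotProduct_mulVec_nonneg v.ofLp
  have : (r • v).ofLp ⬝ᵥ S *ᵥ (r • v).ofLp = |r| ^ (2 : ℝ) * (v.ofLp ⬝ᵥ S *ᵥ v.ofLp) := by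
    simp [Matrix.mulVec_smul]
    ring
  rw [ellipticalExponent, this, Real.mul_rpow (by positivity) hq, ← Real.rpow_mul (abs_nonneg r)]
  congr 2
  ring

theorem adjoint_toEuclideanCLM {A : Matrix (Fin d) (Fin d) ℝ} (hA : A.IsHermitian) :
    (Matrix.toEuclideanCLM (𝕜 := ℝ) (n := Fin d) A).adjoint
      = Matrix.toEuclideanCLM (𝕜 := ℝ) (n := Fin d) A := by
  rw [← ContinuousLinearMap.star_eq_adjoint, ← map_star, Matrix.star_eq_conjTranspose, hA.eq]

theorem finalKernel_eq_cfc (hH : H.IsHermitian) (t : ℝ≥0) :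
    finalKernel H α c t = Matrix.toEuclideanCLM (𝕜 := ℝ) (n := Fin d)
      (hH.cfc fun x => Real.exp (-((t : ℝ) * (x - (1 - α⁻¹) / c)))) := by
  rw [finalKernel, hH.exp_eq_cfc]

theorem continuous_finalKernel (hH : H.IsHermitian) : Continuous (finalKernel H α c) := by
  have hlin : Continuous fun A : Matrix (Fin d) (Fin d) ℝ =>
      Matrix.toEuclideanCLM (𝕜 := ℝ) (n := Fin d) A :=
    LinearMap.continuous_of_finiteDimensional
      { toFun := Matrix.toEuclideanCLM (𝕜 := ℝ) (n := Fin d)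
        map_add' := map_add _
        map_smul' := map_smul _ }
  have h : finalKernel H α c = fun t : ℝ≥0 => Matrix.toEuclideanCLM (𝕜 := ℝ) (n := Fin d)
      (hH.cfc fun x => Real.exp (-((t : ℝ) * (x - (1 - α⁻¹) / c)))) :=
    funext fun t => finalKernel_eq_cfc hH t
  rw [h]
  refine hlin.comp ?_
  simp_rw [hH.cfc_conj]
  fun_prop

/-- The exponents of both limit laws in direction `u`, expressed by the same weights on the
eigenvalues of `H`. -/
theorem exists_weights_ellipticalExponent (hH : H.PosDef) (hS : S.PosSemidef)
    (hcomm : S * H = H * S) (u : EuclideanSpace ℝ (Fin d)) :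
    ∃ w : Fin d → ℝ, (∀ i, 0 ≤ w i) ∧
      (∀ t : ℝ, 0 < t → ellipticalExponent S α ((finalKernel H α c t.toNNReal).adjoint u)
        = (∑ i, w i * Real.exp (-(t * (hH.isHermitian.eigenvalues i - (1 - α⁻¹) / c))) ^ 2)
          ^ (α / 2)) ∧
      ellipticalExponent S α ((Matrix.toEuclideanCLM (𝕜 := ℝ) (n := Fin d) H⁻¹).adjoint u)
        = (∑ i, w i * (hH.isHermitian.eigenvalues i)⁻¹ ^ 2) ^ (α / 2) := by
  obtain ⟨w, hw, hwg⟩ := hH.isHermitian.exists_weights hS hcomm u.ofLp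
  refine ⟨w, hw, fun t ht => ?_, ?_⟩
  · rw [finalKernel_eq_cfc hH.isHermitian,
      adjoint_toEuclideanCLM (hH.isHermitian.isHermitian_cfc _), ellipticalExponent,
      Matrix.ofLp_toEuclideanCLM, hwg, Real.coe_toNNReal _ ht.le]
  · rw [hH.inv_eq_cfc, adjoint_toEuclideanCLM (hH.isHermitian.isHermitian_cfc _),
      ellipticalExponent, Matrix.ofLp_toEuclideanCLM, hwg]

theorem integrableOn_ellipticalExponent_finalKernel (hα : 0 < α) (hH : H.PosDef)
    (hS : S.PosSemidef) (hcomm : S * H = H * S)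
    (hcH : ∀ i, (1 - α⁻¹) / c < hH.isHermitian.eigenvalues i) (u : EuclideanSpace ℝ (Fin d)) :
    IntegrableOn (fun t : ℝ => ellipticalExponent S α ((finalKernel H α c t.toNNReal).adjoint u))
      (Set.Ioi 0) := by
  obtain ⟨w, hw, hwt, -⟩ := exists_weights_ellipticalExponent (α := α) (c := c) hH hS hcomm u
  exact (integrableOn_rpow_sum_exp hw (fun i => sub_pos.2 (hcH i)) (half_pos hα)).congr_fun
    (fun t ht => (hwt t ht).symm) measurableSet_Ioi

theorem ellipticalExponent_inv_le_integral (hα₁ : 1 < α) (hα₂ : α < 2) (hc : 0 < c)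
    (hH : H.PosDef) (hS : S.PosSemidef) (hcomm : S * H = H * S)
    (hcH : ∀ i, (1 - α⁻¹) / c < hH.isHermitian.eigenvalues i) (u : EuclideanSpace ℝ (Fin d)) :
    ellipticalExponent S α ((Matrix.toEuclideanCLM (𝕜 := ℝ) (n := Fin d) H⁻¹).adjoint u)
      ≤ c ^ (α - 1) * ∫ t in Set.Ioi (0 : ℝ),
        ellipticalExponent S α ((finalKernel H α c t.toNNReal).adjoint u) := by
  obtain ⟨w, hw, hwt, hwi⟩ := exists_weights_ellipticalExponent (α := α) (c := c) hH hS hcomm u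
  rw [setIntegral_congr_fun measurableSet_Ioi hwt, hwi]
  exact rpow_sum_inv_sq_le_integral hα₁ hα₂ hc hw hH.eigenvalues_pos hcH

end Final

theorem theorem2p3 {d : ℕ} {α c : ℝ} (hα₁ : 1 < α) (hα₂ : α < 2) (hc : 0 < c)
    {H S : Matrix (Fin d) (Fin d) ℝ} (hH : H.PosDef) (hS : S.PosDef) (hcomm : S * H = H * S)
    -- the step-size constant exceeds `(1 - 1/α) / λ` for every eigenvalue `λ` of `H`
    (hcH : ∀ i, (1 - α⁻¹) / hH.isHermitian.eigenvalues i < c)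
    {Ω : Type*} [MeasurableSpace Ω] (P : Measure Ω) [IsProbabilityMeasure P]
    (L : ℝ≥0 → Ω → EuclideanSpace ℝ (Fin d)) (hL : IsLevyProcess L P)
    -- elliptically contoured with scale matrix `S`: `log E exp(i ⟨u, L_t⟩) = -t (uᵀ S u)^(α/2)`
    (hell : ∀ (t : ℝ≥0) (u : EuclideanSpace ℝ (Fin d)), charFun (P.map (L t)) u =
      Complex.exp (-(((t : ℝ) * (u.ofLp ⬝ᵥ S *ᵥ u.ofLp) ^ (α / 2) : ℝ) : ℂ))) :
    -- the integral `∫₀^∞ exp(-H₁ t) dL_t` exists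
    (∃ X : Ω → EuclideanSpace ℝ (Fin d), IsImproperLevyIntegral P (finalKernel H α c) L X) ∧
    -- and for each version `X` of it, the laws of `c^(1 - 1/α) X` and `H⁻¹ L₁` have ordered scales
    ∀ X : Ω → EuclideanSpace ℝ (Fin d), IsImproperLevyIntegral P (finalKernel H α c) L X →
      ∀ u : EuclideanSpace ℝ (Fin d), ‖u‖ = 1 →
        ∃ σfinal σPolyak : ℝ,
          HasStableScale α (P.map (fun ω => c ^ (1 - α⁻¹) • X ω)) u σfinal ∧
          HasStableScale α
            (P.map (fun ω => Matrix.toEuclideanCLM (𝕜 := ℝ) (n := Fin d) H⁻¹ (L 1 ω))) u σPolyak ∧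
          σPolyak ≤ σfinal := by
  have hα : 0 < α := by linarith
  have hSs := hS.posSemidef
  have hφ : ∀ (t : ℝ≥0) (u : EuclideanSpace ℝ (Fin d)), charFun (P.map (L t)) u
      = Complex.exp (-((t * ellipticalExponent S α u : ℝ) : ℂ)) := hell
  have hφ0 : ellipticalExponent S α 0 = 0 := ellipticalExponent_zero hα
  have hφc := continuous_ellipticalExponent (S := S) hα
  have hf := continuous_finalKernel (α := α) (c := c) hH.isHermitian
  have hcH' : ∀ i, (1 - α⁻¹) / c < hH.isHermitian.eigenvalues i := fun i => by
    rw [div_lt_comm₀ hc (hH.eigenvalues_pos i)]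
    exact hcH i
  have hint := integrableOn_ellipticalExponent_finalKernel hα hH hSs hcomm hcH'
  refine ⟨hL.exists_isImproperLevyIntegral hφ hφ0 ellipticalExponent_neg hφc hf hint,
    fun X hX u _ => ?_⟩
  refine ⟨c ^ (α - 1) * ∫ t in Set.Ioi (0 : ℝ),
      ellipticalExponent S α ((finalKernel H α c t.toNNReal).adjoint u),
    ellipticalExponent S α ((Matrix.toEuclideanCLM (𝕜 := ℝ) (n := Fin d) H⁻¹).adjoint u),
    ⟨0, fun s => ?_⟩, ⟨0, fun s => ?_⟩,
    ellipticalExponent_inv_le_integral hα₁ hα₂ hc hH hSs hcomm hcH' u⟩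
  · rw [charFun_map_smul_comp (hX.aemeasurable hL),
      hX.charFun_eq hL hφ hφ0 ellipticalExponent_neg hφc hf (hint _)]
    have hpow : |c ^ (1 - α⁻¹)| ^ α = c ^ (α - 1) := by
      rw [abs_of_pos (Real.rpow_pos_of_pos hc _), ← Real.rpow_mul hc.le]
      congr 1
      field_simp
    simp_rw [map_smul, ellipticalExponent_smul hSs]
    rw [integral_const_mul, integral_const_mul, hpow]
    congr 1
    push_cast
    ring
  · have hmap : P.map (fun ω => Matrix.toEuclideanCLM (𝕜 := ℝ) (n := Fin d) H⁻¹ (L 1 ω))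
        = (P.map (L 1)).map (Matrix.toEuclideanCLM (𝕜 := ℝ) (n := Fin d) H⁻¹) := by
      rw [Measure.map_map (ContinuousLinearMap.measurable _) (hL.measurable 1)]
      rfl
    rw [hmap, charFun_map_continuousLinearMap, hφ, map_smul, ellipticalExponent_smul hSs]
    congr 1
    push_cast
    ring
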